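/- Let $d\ge 1$, $H=(H_1,\dots,H_d)\in(0,1)^d$, and let $B^H=\{B^H(t),\,t\in\mathbb{R}^d\}$ be a fractional Brownian sheet: a (measurable version of a) real mean-zero Gaussian field with $$\mathbb{E}\,B^H(s)B^H(t)=\frac1{2^d}\prod_{i=1}^d\bigl(|s_i|^{2H_i}+|t_i|^{2H_i}-|s_i-t_i|^{2H_i}\bigr),\qquad s,t\in\mathbb{R}^d .$$ For $d=1$ this is fractional Brownian motion (fBm). Let $\psi\in L^2(\mathbb{R})$ be a real, compactly supported orthonormal wavelet, i.e. the functions $\psi_{j,k}(t)=2^{-j/2}\psi(2^{-j}t-k)$, $j,k\in\mathbb{Z}$, form an orthonormal basis of $L^2(\mathbb{R})$, and suppose that $\psi$ has $N\ge1$ vanishing moments: $\int t^k\psi(t)\,dt=0$ for $0\le k<N$ and $\int t^N\psi(t)\,dt\ne0$. For $J=(j_1,\dots,j_d)$, $K=(k_1,\dots,k_d)\in\mathbb{Z}^d$ put $$d_{B^H}(J,K)=\int_{\mathbb{R}^d}\psi_{j_1,k_1}(t_1)\cdots\psi_{j_d,k_d}(t_d)\,B^H(t)\,dt ,$$ where the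 integral is taken path by path. Then: (i) For all $J,K\in\mathbb{Z}^d$ the integral converges absolutely almost surely, $d_{B^H}(J,K)$ is Gaussian, and $\mathbb{E}\,d_{B^H}(J,K)=0$. (ii) For all $J,K_1,\dots,K_n\in\mathbb{Z}^d$, $$\bigl(d_{B^H}(J,K_1),\dots,d_{B^H}(J,K_n)\bigr)\overset{d}{=}2^{\sum_{i=1}^d j_i(H_i+1/2)}\bigl(d_{B^H}(\mathbf 0,K_1),\dots,d_{B^H}(\mathbf 0,K_n)\bigr).$$ (iii) For all $J,K_1,\dots,K_n,L\in\mathbb{Z}^d$, $$\bigl(d_{B^H}(J,K_1+L),\dots,d_{B^H}(J,K_n+L)\bigr)\overset{d}{=}\bigl(d_{B^H}(J,K_1),\dots,d_{B^H}(J,K_n)\bigr).$$ (iv) For all $J,J',K,K'\in\mathbb{Z}^d$, $$\mathbb{E}\,d_{B^H}(J,K)d_{B^H}(J',K')=\prod_{i=1}^d\int_{\mathbb{R}}\int_{\mathbb{R}}\psi_{j_i,k_i}(t)\psi_{j'_i,k'_i}(s)\,\tfrac12\bigl(|s|^{2H_i}+|t|^{2H_i}-|s-t|^{2H_i}\bigr)\,ds\,dt=\prod_{i=1}^d\mathbb{E}\,d_{B^{H_i}}(j_i,k_i)\,d_{B^{H_i}}(j'_i,k'_i),$$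 where $B^{H_i}$ is any (measurable) fBm with Hurst parameter $H_i$. Moreover, for fixed $J,J'$ there is a constant $C$ with $$\frac{\mathbb{E}\,d_{B^H}(J,K)d_{B^H}(J',K')}{\prod_{i=1}^d|2^{j_i}k_i-2^{j'_i}k'_i|^{2H_i-2N}}\longrightarrow C\qquad\text{as }\min_{1\le i\le d}|2^{j_i}k_i-2^{j'_i}k'_i|\to\infty .$$ Here $C\ne0$ if $H_i\ne\frac12$ for all $i$. If $H_i=\frac12$ for some $i$, then the covariance is equal to $0$ as soon as $\min_i|2^{j_i}k_i-2^{j'_i}k'_i|$ is large enough. -/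

import Mathlib

open MeasureTheory ProbabilityTheory Filter Topology

noncomputable section

/-- The dilated and translated function `ψ_{j,k}(t) = 2^{-j/2} ψ(2^{-j} t - k)`. -/
def waveletFn (ψ : ℝ → ℝ) (j k : ℤ) (t : ℝ) : ℝ :=
  (2 : ℝ) ^ (-(j : ℝ) / 2) * ψ ((2 : ℝ) ^ (-j) * t - (k : ℝ))

/-- `ψ` is a (real) orthonormal wavelet: `ψ ∈ L²(ℝ)` and the functions `ψ_{j,k}`, `j, k ∈ ℤ`,
form an orthonormal (Hilbert) basis of `L²(ℝ)`. -/
structure IsOrthonormalWavelet (ψ : ℝ → ℝ) : Prop where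
  memLp : MemLp ψ 2 volume
  basis : ∃ b : HilbertBasis (ℤ × ℤ) ℝ (Lp ℝ 2 (volume : Measure ℝ)),
    ∀ j k : ℤ, (b (j, k) : ℝ → ℝ) =ᵐ[volume] waveletFn ψ j k

/-- `ψ` has (exactly) `N` vanishing moments: `∫ t^k ψ(t) dt = 0` for `k < N` and
`∫ t^N ψ(t) dt ≠ 0`, the integrals being absolutely convergent. -/
structure HasVanishingMoments (ψ : ℝ → ℝ) (N : ℕ) : Prop where
  integrable : ∀ k ≤ N, Integrable (fun t : ℝ => t ^ k * ψ t) volume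
  moment_eq_zero : ∀ k < N, ∫ t : ℝ, t ^ k * ψ t = 0
  moment_ne_zero : ∫ t : ℝ, t ^ N * ψ t ≠ 0

/-- The covariance function `(|s|^{2h} + |t|^{2h} - |s - t|^{2h}) / 2` of fractional Brownian
motion with Hurst parameter `h`. -/
def fbmCov (h s t : ℝ) : ℝ :=
  (1 / 2) * (|s| ^ (2 * h) + |t| ^ (2 * h) - |s - t| ^ (2 * h))

/-- `B = {B(t), t ∈ ℝ^d}` is a fractional Brownian sheet with Hurst parameter
`H = (H_1, …, H_d)`: a mean-zero Gaussian field whose covariance function is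
`2^{-d} ∏ (|s_i|^{2H_i} + |t_i|^{2H_i} - |s_i - t_i|^{2H_i})`.
For `d = 1` this is fractional Brownian motion. -/
structure IsFractionalBrownianSheet {d : ℕ} {Ω : Type*} [MeasurableSpace Ω]
    (H : Fin d → ℝ) (B : (Fin d → ℝ) → Ω → ℝ) (P : Measure Ω) : Prop where
  gaussian : IsGaussianProcess B P
  mean_zero : ∀ t, ∫ ω, B t ω ∂P = 0
  cov : ∀ s t, ∫ ω, B s ω * B t ω ∂P = ∏ i, fbmCov (H i) (s i) (t i)

/-- The tensor product wavelet `ψ_{j_1,k_1}(t_1) ⋯ ψ_{j_d,k_d}(t_d)`. -/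
def tensorWavelet {d : ℕ} (ψ : ℝ → ℝ) (J K : Fin d → ℤ) (t : Fin d → ℝ) : ℝ :=
  ∏ i, waveletFn ψ (J i) (K i) (t i)

/-- The wavelet coefficient `d_B(J,K) = ∫ ψ_{j_1,k_1}(t_1) ⋯ ψ_{j_d,k_d}(t_d) B(t) dt`, a random
variable (the integral is taken path by path). -/
def waveletCoeff {d : ℕ} {Ω : Type*} (ψ : ℝ → ℝ) (B : (Fin d → ℝ) → Ω → ℝ)
    (J K : Fin d → ℤ) (ω : Ω) : ℝ :=
  ∫ t : Fin d → ℝ, tensorWavelet ψ J K t * B t ω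

/-- The filter on pairs `(K, K')` that describes the limit
`min_i |2^{j_i} k_i - 2^{j'_i} k'_i| → ∞` for fixed `J`, `J'`. -/
def farApart {d : ℕ} (J J' : Fin d → ℤ) : Filter ((Fin d → ℤ) × (Fin d → ℤ)) :=
  comap (fun p => ⨅ i, |(2 : ℝ) ^ (J i) * (p.1 i : ℝ) - (2 : ℝ) ^ (J' i) * (p.2 i : ℝ)|) atTop

end

/-!
The coefficients `d(J, K)` are path-by-path integrals `∫ f(t) B(t) dt` with `f` integrable and
compactly supported, and everything follows from their covariances once they are known to be
jointly Gaussian.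

*Gaussianity.* If `Y ∈ L²(P)` is orthogonal to all the `B(t)`, then Fubini gives
`E[d(J, K) Y] = ∫ f(t) E[B(t) Y] dt = 0`. Hence `d(J, K)` lies in the bi-orthogonal complement of
the `B(t)`, that is, in the closed linear span of the process in `L²(P)`
(`integral_mem_gaussianSpace`). On this span `E exp(iZ) = exp(-‖Z‖² / 2)`, because both sides are
continuous in `Z` and agree on finite linear combinations
(`integral_cexp_of_mem_gaussianSpace`). So finite families in the span are centered Gaussian
vectors whose law is determined by the covariances (`identDistrib_of_mem_gaussianSpace`).

*Covariances.* Fubini and the product structure of the covariance and of the tensor wavelet give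
the factorization into one-dimensional double integrals. Since `∫ ψ = 0`, a change of variables
reduces each factor to `-(1/2) 2^{(j + j')/2}` times
`∬ ψ(u) ψ(v) |x + (2^j u - 2^{j'} v)|^{2h} du dv`, with `x = 2^j k - 2^{j'} k'`
(`integral_integral_waveletFn_fbmCov`). For `j = j'` this is homogeneous in `2^j` and depends on
`k - k'` only, which gives scaling and stationarity.

*Decay.* For large `|x|` one has `|x + y|^{2h} = |x|^{2h} (1 + y / x)^{2h}` uniformly over the
compact support, and the right side has a binomial expansion in `y / x`. A monomial `u^a v^b` with
`a + b < 2N` has `a < N` or `b < N`, so it integrates to `0` against `ψ(u) ψ(v)`; in degree `2N`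
only `u^N v^N` survives, with the coefficient `binom(2h, 2N)`, which vanishes for `0 < h < 1` only
if `h = 1/2` (`tendsto_waveletKernel_div`). For `h = 1/2` the expansion stops at degree one, and the
integral is exactly zero for large `|x|` (`waveletKernel_half_eventually_eq_zero`).
-/

/-! ### Compactly supported weights -/

lemma MeasureTheory.Integrable.mul_continuous_of_isCompact {X : Type*} [TopologicalSpace X]
    [MeasurableSpace X] [OpensMeasurableSpace X] [T2Space X] [SecondCountableTopology X]
    {μ : Measure X} {f g : X → ℝ} {K : Set X} (hf : Integrable f μ) (hK : IsCompact K)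
    (h0 : ∀ x ∉ K, f x = 0) (hg : Continuous g) : Integrable (fun x => f x * g x) μ := by
  rw [← integrableOn_iff_integrable_of_support_subset (s := K)]
  · exact hf.integrableOn.mul_continuousOn hg.continuousOn hK
  · intro x hx
    by_contra h
    exact hx (by simp [h0 x h])

section Kernel

variable {ψ : ℝ → ℝ}

lemma integrable_mul_continuous (hψ : Integrable ψ) (hs : HasCompactSupport ψ) {g : ℝ → ℝ}
    (hg : Continuous g) : Integrable (fun u => ψ u * g u) :=
  hψ.mul_continuous_of_isCompact hs.isCompact (fun _ hx => image_eq_zero_of_notMem_tsupport hx) hg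

lemma integrable_mul_mul_continuous (hψ : Integrable ψ) (hs : HasCompactSupport ψ)
    {g : ℝ × ℝ → ℝ} (hg : Continuous g) :
    Integrable (fun p : ℝ × ℝ => ψ p.1 * ψ p.2 * g p) := by
  refine (hψ.mul_prod hψ).mul_continuous_of_isCompact (hs.isCompact.prod hs.isCompact)
    (fun p hp => ?_) hg
  rw [Set.mem_prod, not_and_or] at hp
  rcases hp with hp | hp <;> simp [image_eq_zero_of_notMem_tsupport hp]

lemma HasCompactSupport.exists_abs_le (hs : HasCompactSupport ψ) :
    ∃ R, 0 < R ∧ ∀ u, ψ u ≠ 0 → |u| ≤ R := by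
  obtain ⟨R, hR⟩ := hs.isCompact.isBounded.exists_norm_le
  exact ⟨max R 1, by positivity, fun u hu =>
    (hR u (subset_tsupport _ hu)).trans (le_max_left _ _)⟩

/-! ### Reduction of the one-dimensional covariance to the increment kernel -/

lemma integral_waveletFn_mul (j k : ℤ) (g : ℝ → ℝ) :
    ∫ t, waveletFn ψ j k t * g t =
      (2 : ℝ) ^ ((j : ℝ) / 2) * ∫ u, ψ u * g ((2 : ℝ) ^ j * (u + k)) := by
  have h2 : (0 : ℝ) < 2 ^ j := by positivity
  have h1 : ∫ u, ψ u * g ((2 : ℝ) ^ j * (u + k)) =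
      ((2 : ℝ) ^ j)⁻¹ * ∫ t, ψ ((2 : ℝ) ^ (-j) * t - k) * g t := by
    have e := integral_add_right_eq_self (μ := (volume : Measure ℝ))
      (fun u : ℝ => ψ (u - k) * g ((2 : ℝ) ^ j * u)) (k : ℝ)
    simp only [add_sub_cancel_right] at e
    rw [e]
    have e2 := Measure.integral_comp_mul_left
      (fun t : ℝ => ψ ((2 : ℝ) ^ (-j) * t - k) * g t) ((2 : ℝ) ^ j)
    rw [abs_of_pos (inv_pos.2 h2), smul_eq_mul] at e2
    rw [← e2]
    refine integral_congr_ae (ae_of_all _ fun u => ?_)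
    simp only [zpow_neg, inv_mul_cancel_left₀ h2.ne']
  -- the Jacobian `2 ^ j` turns the normalization `2 ^ (-j / 2)` into `2 ^ (j / 2)`
  have h3 : (2 : ℝ) ^ (-(j : ℝ) / 2) = 2 ^ ((j : ℝ) / 2) * ((2 : ℝ) ^ j)⁻¹ := by
    rw [← Real.rpow_intCast, ← Real.rpow_neg (by norm_num), ← Real.rpow_add (by norm_num)]
    congr 1
    ring
  simp only [waveletFn, mul_assoc, integral_const_mul]
  rw [h1, h3]
  ring

/-- The double integral `∬ ψ(u) ψ(v) |x + (a u - b v)|^{2h} du dv`; up to a constant it is the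
covariance of two wavelet coefficients of fractional Brownian motion at the scales `a` and `b`,
taken at distance `x`. -/
noncomputable def waveletKernel (ψ : ℝ → ℝ) (h a b x : ℝ) : ℝ :=
  ∫ p : ℝ × ℝ, ψ p.1 * ψ p.2 * |x + (a * p.1 - b * p.2)| ^ (2 * h)

/-- Since `∫ ψ = 0`, only the term `-|s - t|^{2h} / 2` of the covariance contributes. -/
lemma integral_integral_fbmCov (hψ : Integrable ψ) (hs : HasCompactSupport ψ)
    (h0 : ∫ u, ψ u = 0) {h : ℝ} (hh : 0 < h) {σ τ : ℝ → ℝ} (hσ : Continuous σ)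
    (hτ : Continuous τ) :
    ∫ u, ψ u * ∫ v, ψ v * fbmCov h (σ v) (τ u) =
      -(1 / 2) * ∫ p : ℝ × ℝ, ψ p.1 * ψ p.2 * |τ p.1 - σ p.2| ^ (2 * h) := by
  have hp : (0 : ℝ) ≤ 2 * h := by positivity
  have i1 : Integrable fun v => ψ v * |σ v| ^ (2 * h) :=
    integrable_mul_continuous hψ hs (hσ.abs.rpow_const fun _ => Or.inr hp)
  have i2 : ∀ u, Integrable fun v => ψ v * |τ u - σ v| ^ (2 * h) := fun u =>
    integrable_mul_continuous hψ hs ((continuous_const.sub hσ).abs.rpow_const fun _ => Or.inr hp)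
  have i3 : Integrable fun p : ℝ × ℝ => ψ p.1 * ψ p.2 * |τ p.1 - σ p.2| ^ (2 * h) :=
    integrable_mul_mul_continuous hψ hs (((hτ.comp continuous_fst).sub
      (hσ.comp continuous_snd)).abs.rpow_const fun _ => Or.inr hp)
  have hin : ∀ u, ψ u * ∫ v, ψ v * fbmCov h (σ v) (τ u) =
      ψ u * (1 / 2 * ∫ v, ψ v * |σ v| ^ (2 * h)) +
        -(1 / 2) * ∫ v, ψ u * ψ v * |τ u - σ v| ^ (2 * h) := fun u => by
    have e : ∀ v, ψ v * fbmCov h (σ v) (τ u) = 1 / 2 * (ψ v * |σ v| ^ (2 * h)) +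
        1 / 2 * |τ u| ^ (2 * h) * ψ v - 1 / 2 * (ψ v * |τ u - σ v| ^ (2 * h)) := fun v => by
      rw [fbmCov, abs_sub_comm (σ v)]; ring
    have j1 := i1.const_mul (1 / 2)
    have j2 := hψ.const_mul (1 / 2 * |τ u| ^ (2 * h))
    have j3 : Integrable fun v => 1 / 2 * (ψ v * |σ v| ^ (2 * h)) +
      1 / 2 * |τ u| ^ (2 * h) * ψ v := j1.add j2
    simp_rw [e]
    rw [integral_sub j3 ((i2 u).const_mul _), integral_add j1 j2, integral_const_mul,
      integral_const_mul, integral_const_mul, h0]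
    simp_rw [mul_assoc (ψ u)]
    rw [integral_const_mul]
    ring
  simp_rw [hin]
  rw [integral_add (hψ.mul_const _) (i3.integral_prod_left.const_mul _), integral_mul_const,
    integral_const_mul, h0, zero_mul, zero_add]
  congr 1
  exact (integral_prod _ i3).symm

lemma integral_integral_waveletFn_fbmCov (hψ : Integrable ψ) (hs : HasCompactSupport ψ)
    (h0 : ∫ u, ψ u = 0) {h : ℝ} (hh : 0 < h) (j k j' k' : ℤ) :
    ∫ t, ∫ s, waveletFn ψ j k t * waveletFn ψ j' k' s * fbmCov h s t =
      -(1 / 2) * ((2 : ℝ) ^ ((j : ℝ) / 2) * (2 : ℝ) ^ ((j' : ℝ) / 2)) *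
        waveletKernel ψ h (2 ^ j) (2 ^ j') (2 ^ j * k - 2 ^ j' * k') := by
  simp_rw [mul_assoc (waveletFn ψ j k _), integral_const_mul, integral_waveletFn_mul,
    mul_left_comm (ψ _), integral_const_mul]
  rw [integral_integral_fbmCov hψ hs h0 hh (σ := fun v => (2 : ℝ) ^ j' * (v + k'))
    (τ := fun u => (2 : ℝ) ^ j * (u + k)) (by fun_prop) (by fun_prop), waveletKernel]
  have e : ∀ p : ℝ × ℝ, (2 : ℝ) ^ j * (p.1 + k) - 2 ^ j' * (p.2 + k') =
    2 ^ j * k - 2 ^ j' * k' + (2 ^ j * p.1 - 2 ^ j' * p.2) := fun p => by ring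
  simp_rw [e]
  ring

lemma waveletKernel_mul {a : ℝ} (ha : 0 < a) (h x : ℝ) :
    waveletKernel ψ h a a (a * x) = a ^ (2 * h) * waveletKernel ψ h 1 1 x := by
  rw [waveletKernel, waveletKernel, ← integral_const_mul]
  refine integral_congr_ae (ae_of_all _ fun p => ?_)
  have e : a * x + (a * p.1 - a * p.2) = a * (x + (1 * p.1 - 1 * p.2)) := by ring
  simp only [e]
  rw [abs_mul, abs_of_pos ha, Real.mul_rpow ha.le (abs_nonneg _)]
  ring

/-! ### Asymptotics of the increment kernel -/

/-- Binomial expansion of the moments of the weight `ψ(u) ψ(v)` along `a u - b v`. -/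
lemma integral_mul_mul_pow (hψ : Integrable ψ) (hs : HasCompactSupport ψ) (a b : ℝ) (m : ℕ) :
    ∫ p : ℝ × ℝ, ψ p.1 * ψ p.2 * (a * p.1 - b * p.2) ^ m =
      ∑ k ∈ Finset.range (m + 1), a ^ k * (-b) ^ (m - k) * (m.choose k : ℝ) *
        ((∫ u, u ^ k * ψ u) * ∫ v, v ^ (m - k) * ψ v) := by
  have hint : ∀ k : ℕ, Integrable fun u : ℝ => u ^ k * ψ u := fun k => by
    simpa only [mul_comm] using integrable_mul_continuous hψ hs (continuous_pow k)
  have e : ∀ p : ℝ × ℝ, ψ p.1 * ψ p.2 * (a * p.1 - b * p.2) ^ m =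
      ∑ k ∈ Finset.range (m + 1), a ^ k * (-b) ^ (m - k) * (m.choose k : ℝ) *
        ((p.1 ^ k * ψ p.1) * (p.2 ^ (m - k) * ψ p.2)) := fun p => by
    rw [sub_eq_add_neg, ← neg_mul, add_pow, Finset.mul_sum]
    refine Finset.sum_congr rfl fun k _ => ?_
    rw [mul_pow, mul_pow]
    ring
  simp_rw [e]
  rw [Measure.volume_eq_prod, integral_finsetSum _ fun k _ =>
    ((hint k).mul_prod (hint (m - k))).const_mul _]
  refine Finset.sum_congr rfl fun k _ => ?_
  rw [integral_const_mul]
  congr 1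
  exact integral_prod_mul (μ := volume) (ν := volume) (fun u : ℝ => u ^ k * ψ u)
    (fun v : ℝ => v ^ (m - k) * ψ v)

/-- If `ψ` has `N` vanishing moments, then `ψ ⊗ ψ` kills polynomials of degree less
than `2 N` in `a u - b v`. -/
lemma integral_mul_mul_pow_eq_zero (hψ : Integrable ψ) (hs : HasCompactSupport ψ) {N : ℕ}
    (hmom : ∀ k < N, ∫ t : ℝ, t ^ k * ψ t = 0) (a b : ℝ) {m : ℕ} (hm : m < 2 * N) :
    ∫ p : ℝ × ℝ, ψ p.1 * ψ p.2 * (a * p.1 - b * p.2) ^ m = 0 := by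
  rw [integral_mul_mul_pow hψ hs]
  refine Finset.sum_eq_zero fun k _ => ?_
  rcases lt_or_ge k N with hk | hk
  · rw [hmom k hk, zero_mul, mul_zero]
  · rw [hmom (m - k) (by omega), mul_zero, mul_zero]

lemma integral_mul_mul_pow_two_mul (hψ : Integrable ψ) (hs : HasCompactSupport ψ) {N : ℕ}
    (hmom : ∀ k < N, ∫ t : ℝ, t ^ k * ψ t = 0) (a b : ℝ) :
    ∫ p : ℝ × ℝ, ψ p.1 * ψ p.2 * (a * p.1 - b * p.2) ^ (2 * N) =
      a ^ N * (-b) ^ N * ((2 * N).choose N : ℝ) * (∫ t : ℝ, t ^ N * ψ t) ^ 2 := by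
  rw [integral_mul_mul_pow hψ hs, Finset.sum_eq_single N]
  · rw [show 2 * N - N = N by omega, sq]
  · intro k _ hk
    rcases lt_or_gt_of_ne hk with hk | hk
    · rw [hmom k hk, zero_mul, mul_zero]
    · rcases le_or_gt k (2 * N) with hk2 | hk2
      · rw [hmom (2 * N - k) (by omega), mul_zero, mul_zero]
      · simp [Nat.choose_eq_zero_of_lt hk2]
  · intro hN
    exact absurd (Finset.mem_range.2 (by omega)) hN

lemma abs_rpow_add_eq {x y : ℝ} (hxy : |y| < |x|) (r : ℝ) :
    |x + y| ^ r = |x| ^ r * (1 + y / x) ^ r := by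
  have hx : x ≠ 0 := by
    rintro rfl
    simp at hxy
    linarith [abs_nonneg y]
  have h1 : |y / x| < 1 := by
    rw [abs_div, div_lt_one (abs_pos.2 hx)]
    exact hxy
  have h2 : 0 < 1 + y / x := by linarith [(abs_lt.1 h1).1]
  rw [← Real.mul_rpow (abs_nonneg x) h2.le]
  congr 1
  rw [← abs_of_pos h2, ← abs_mul]
  congr 1
  field_simp

/-- For `h = 1/2` the integrand is affine in `a u - b v` as soon as `|x|` exceeds the size of the
support, hence the kernel vanishes. -/
lemma waveletKernel_half_eventually_eq_zero (hψ : Integrable ψ) (hs : HasCompactSupport ψ) {N : ℕ}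
    (hN : 1 ≤ N) (hmom : ∀ k < N, ∫ t : ℝ, t ^ k * ψ t = 0) (a b : ℝ) :
    ∀ᶠ x in comap (fun x : ℝ => |x|) atTop, waveletKernel ψ (1 / 2) a b x = 0 := by
  obtain ⟨R, hR, hsR⟩ := hs.exists_abs_le
  refine (eventually_gt_atTop (|a| * R + |b| * R)).comap _ |>.mono fun x hx => ?_
  have h0 := integral_mul_mul_pow_eq_zero hψ hs hmom a b (m := 0) (by omega)
  have h1 := integral_mul_mul_pow_eq_zero hψ hs hmom a b (m := 1) (by omega)
  have i0 := integrable_mul_mul_continuous hψ hs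
    (by fun_prop : Continuous fun p : ℝ × ℝ => (a * p.1 - b * p.2) ^ 0)
  have i1 := integrable_mul_mul_continuous hψ hs
    (by fun_prop : Continuous fun p : ℝ × ℝ => (a * p.1 - b * p.2) ^ 1)
  -- `|x + y| = |x| + (|x| / x) * y`, the sign of `x` being that of `x + y`
  have e : ∀ p : ℝ × ℝ, ψ p.1 * ψ p.2 * |x + (a * p.1 - b * p.2)| ^ (2 * (1 / 2 : ℝ)) =
      |x| * (ψ p.1 * ψ p.2 * (a * p.1 - b * p.2) ^ 0) +
        |x| / x * (ψ p.1 * ψ p.2 * (a * p.1 - b * p.2) ^ 1) := fun p => by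
    by_cases hp : ψ p.1 = 0 ∨ ψ p.2 = 0
    · rcases hp with hp | hp <;> simp [hp]
    · rw [not_or] at hp
      have hy : |a * p.1 - b * p.2| < |x| := by
        refine lt_of_le_of_lt ((abs_sub _ _).trans ?_) hx
        rw [abs_mul, abs_mul]
        gcongr
        exacts [hsR _ hp.1, hsR _ hp.2]
      rw [abs_rpow_add_eq hy]
      norm_num
      ring
  rw [waveletKernel]
  simp_rw [e]
  rw [integral_add (i0.const_mul _) (i1.const_mul _), integral_const_mul, integral_const_mul,
    h0, h1]
  simp

lemma exists_abs_one_add_rpow_sub_le (r : ℝ) (n : ℕ) :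
    ∃ C > 0, ∃ ε > 0, ∀ z : ℝ, |z| < ε →
      |(1 + z) ^ r - ∑ m ∈ Finset.range n, Ring.choose r m * z ^ m| ≤ C * |z| ^ n := by
  have h := (Real.one_add_rpow_hasFPowerSeriesAt_zero (a := r)).isBigO_sub_partialSum_pow n
  obtain ⟨C, hC, hb⟩ := h.exists_pos
  obtain ⟨ε, hε, hball⟩ := Metric.eventually_nhds_iff.1 hb.bound
  refine ⟨C, hC, ε, hε, fun z hz => ?_⟩
  have := hball (y := z) (by simpa using hz)
  simpa [FormalMultilinearSeries.partialSum, binomialSeries, mul_comm] using this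

/-- The increment kernel decays like `|x|^{2h - 2N}`: after the expansion of `(1 + y / x)^{2h}`
in powers of `y / x`, with `y = a u - b v`, the first term that survives the vanishing moments is
the one of degree `2N`. -/
lemma tendsto_waveletKernel_div (hψ : Integrable ψ) (hs : HasCompactSupport ψ) {N : ℕ}
    (hmom : ∀ k < N, ∫ t : ℝ, t ^ k * ψ t = 0) {h : ℝ} (hh : 0 < h) (a b : ℝ) :
    Tendsto (fun x => waveletKernel ψ h a b x / |x| ^ (2 * h - 2 * (N : ℝ)))
      (comap (fun x : ℝ => |x|) atTop)
      (𝓝 (Ring.choose (2 * h) (2 * N) *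
        (a ^ N * (-b) ^ N * ((2 * N).choose N : ℝ) * (∫ t : ℝ, t ^ N * ψ t) ^ 2))) := by
  obtain ⟨R, hR, hsR⟩ := hs.exists_abs_le
  obtain ⟨C, hC, ε, hε, hT⟩ := exists_abs_one_add_rpow_sub_le (2 * h) (2 * N + 1)
  rw [← integral_mul_mul_pow_two_mul hψ hs hmom]
  set G := ∫ p : ℝ × ℝ, ψ p.1 * ψ p.2 * (a * p.1 - b * p.2) ^ (2 * N)
  set M := |a| * R + |b| * R with hM
  have hM0 : 0 ≤ M := by positivity
  set A := ∫ p : ℝ × ℝ, |ψ p.1 * ψ p.2| with hA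
  have habs : Tendsto (fun x : ℝ => |x|) (comap (fun x : ℝ => |x|) atTop) atTop := tendsto_comap
  rw [tendsto_iff_norm_sub_tendsto_zero]
  refine squeeze_zero' (Eventually.of_forall fun _ => norm_nonneg _) ?_
    (habs.const_div_atTop (A * (C * M ^ (2 * N + 1))))
  filter_upwards [habs.eventually_gt_atTop M, habs.eventually_gt_atTop (M / ε)] with x hxM hxε
  have hx : 0 < |x| := hM0.trans_lt hxM
  have hcont : ∀ m : ℕ, Continuous fun p : ℝ × ℝ => (a * p.1 - b * p.2) ^ m := fun m => by
    fun_prop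
  -- the Taylor polynomial integrates to its top coefficient, by the vanishing moments
  have hpoly : ∫ p : ℝ × ℝ, ψ p.1 * ψ p.2 * ∑ m ∈ Finset.range (2 * N + 1),
      Ring.choose (2 * h) m * ((a * p.1 - b * p.2) / x) ^ m =
        Ring.choose (2 * h) (2 * N) * G / |x| ^ (2 * N) := by
    have e : ∀ p : ℝ × ℝ, ψ p.1 * ψ p.2 * ∑ m ∈ Finset.range (2 * N + 1),
        Ring.choose (2 * h) m * ((a * p.1 - b * p.2) / x) ^ m =
        ∑ m ∈ Finset.range (2 * N + 1), Ring.choose (2 * h) m / x ^ m *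
          (ψ p.1 * ψ p.2 * (a * p.1 - b * p.2) ^ m) := fun p => by
      rw [Finset.mul_sum]
      refine Finset.sum_congr rfl fun m _ => ?_
      rw [div_pow]
      ring
    simp_rw [e]
    rw [integral_finsetSum _ fun m _ =>
      (integrable_mul_mul_continuous hψ hs (hcont m)).const_mul _, Finset.sum_range_succ,
      Finset.sum_eq_zero, zero_add, integral_const_mul, (even_two_mul N).pow_abs]
    · ring
    · intro m hm
      rw [integral_const_mul, integral_mul_mul_pow_eq_zero hψ hs hmom _ _ (Finset.mem_range.1 hm),
        mul_zero]
  have i1 : Integrable fun p : ℝ × ℝ => ψ p.1 * ψ p.2 * |x + (a * p.1 - b * p.2)| ^ (2 * h) :=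
    integrable_mul_mul_continuous hψ hs
      ((by fun_prop : Continuous fun p : ℝ × ℝ => x + (a * p.1 - b * p.2)).abs.rpow_const
        fun _ => Or.inr (by positivity))
  have i2 : Integrable fun p : ℝ × ℝ => ψ p.1 * ψ p.2 * ∑ m ∈ Finset.range (2 * N + 1),
      Ring.choose (2 * h) m * ((a * p.1 - b * p.2) / x) ^ m :=
    integrable_mul_mul_continuous hψ hs (by fun_prop)
  have hdiff : |waveletKernel ψ h a b x -
      |x| ^ (2 * h) * (Ring.choose (2 * h) (2 * N) * G / |x| ^ (2 * N))| ≤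
      A * (|x| ^ (2 * h) * (C * (M / |x|) ^ (2 * N + 1))) := by
    rw [← hpoly, waveletKernel, ← integral_const_mul, ← integral_sub i1 (i2.const_mul _), hA,
      ← integral_mul_const]
    refine (Real.norm_eq_abs _).symm.trans_le
      (norm_integral_le_of_norm_le ((hψ.mul_prod hψ).abs.mul_const _) (ae_of_all _ fun p => ?_))
    by_cases hp : ψ p.1 = 0 ∨ ψ p.2 = 0
    · rcases hp with hp | hp <;> simp [hp]
    · rw [not_or] at hp
      have hy : |a * p.1 - b * p.2| ≤ M := by
        refine (abs_sub _ _).trans ?_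
        rw [abs_mul, abs_mul, hM]
        gcongr
        exacts [hsR _ hp.1, hsR _ hp.2]
      have hz : |(a * p.1 - b * p.2) / x| ≤ M / |x| := by
        rw [abs_div]
        gcongr
      have hz2 : |(a * p.1 - b * p.2) / x| < ε := by
        refine hz.trans_lt ?_
        rw [div_lt_iff₀ hε] at hxε
        rw [div_lt_iff₀ hx]
        linarith
      rw [abs_rpow_add_eq (hy.trans_lt hxM), mul_left_comm (|x| ^ (2 * h)), ← mul_sub, ← mul_sub,
        Real.norm_eq_abs, abs_mul, abs_mul (|x| ^ (2 * h)),
        abs_of_nonneg (Real.rpow_nonneg (abs_nonneg x) _)]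
      gcongr
      refine (hT _ hz2).trans ?_
      gcongr
  have hq : |x| ^ (2 * h - 2 * (N : ℝ)) = |x| ^ (2 * h) / |x| ^ (2 * N) := by
    rw [Real.rpow_sub hx]
    congr 1
    exact_mod_cast Real.rpow_natCast |x| (2 * N)
  have hxh : 0 < |x| ^ (2 * h) := Real.rpow_pos_of_pos hx _
  rw [hq, Real.norm_eq_abs]
  have e1 : waveletKernel ψ h a b x / (|x| ^ (2 * h) / |x| ^ (2 * N)) -
      Ring.choose (2 * h) (2 * N) * G = (waveletKernel ψ h a b x -
        |x| ^ (2 * h) * (Ring.choose (2 * h) (2 * N) * G / |x| ^ (2 * N))) *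
          (|x| ^ (2 * N) / |x| ^ (2 * h)) := by
    field_simp
  rw [e1, abs_mul, abs_of_pos (by positivity : 0 < |x| ^ (2 * N) / |x| ^ (2 * h))]
  refine (mul_le_mul_of_nonneg_right hdiff (by positivity)).trans_eq ?_
  rw [div_pow, pow_succ |x|]
  field_simp

lemma Ring.choose_ne_zero_of_forall_ne_natCast {r : ℝ} (hr : ∀ k : ℕ, r ≠ k) (n : ℕ) :
    Ring.choose r n ≠ 0 := by
  rw [Ring.choose_eq_smul, ← Polynomial.aeval_eq_smeval, Polynomial.aeval_def,
    Polynomial.eval₂_eq_eval_map, descPochhammer_map, descPochhammer_eval_eq_prod_range]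
  exact smul_ne_zero (by positivity)
    (Finset.prod_ne_zero_iff.2 fun k _ => sub_ne_zero.2 (hr k))

end Kernel

/-! ### Gaussian Hilbert spaces -/

section GaussianSpace

variable {T Ω : Type*} [MeasurableSpace Ω] {P : Measure Ω}

/-- The closed linear span in `L²(P)` of a family of square-integrable random variables. -/
noncomputable def gaussianSpace (B : T → Ω → ℝ) (hB : ∀ t, MemLp (B t) 2 P) :
    Submodule ℝ (Lp ℝ 2 P) :=
  (Submodule.span ℝ (Set.range fun t => (hB t).toLp (B t))).topologicalClosure

lemma norm_cexp_mul_I_sub_cexp_mul_I_le (a b : ℝ) :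
    ‖Complex.exp (a * Complex.I) - Complex.exp (b * Complex.I)‖ ≤ |a - b| := by
  have h : Complex.exp (a * Complex.I) - Complex.exp (b * Complex.I) =
      Complex.exp (b * Complex.I) * (Complex.exp (Complex.I * ((a - b : ℝ) : ℂ)) - 1) := by
    rw [mul_sub, ← Complex.exp_add, mul_one]
    congr 2
    push_cast
    ring
  rw [h, norm_mul, Complex.norm_exp_ofReal_mul_I, one_mul]
  exact Real.norm_exp_I_mul_ofReal_sub_one_le

lemma integrable_cexp_mul_I [IsFiniteMeasure P] {X : Ω → ℝ} (hX : AEStronglyMeasurable X P) :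
    Integrable (fun ω => Complex.exp (X ω * Complex.I)) P := by
  refine Integrable.of_bound (C := 1) ?_ (ae_of_all _ fun ω => ?_)
  · exact (by fun_prop : Continuous fun x : ℝ => Complex.exp (x * Complex.I)
      ).comp_aestronglyMeasurable hX
  · rw [Complex.norm_exp_ofReal_mul_I]

lemma continuous_integral_cexp_mul_I [IsProbabilityMeasure P] :
    Continuous fun Z : Lp ℝ 2 P => ∫ ω, Complex.exp (Z ω * Complex.I) ∂P := by
  refine LipschitzWith.continuous (K := 1) (LipschitzWith.of_dist_le_mul fun Z W => ?_)
  rw [NNReal.coe_one, one_mul, dist_eq_norm, dist_eq_norm,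
    ← integral_sub (integrable_cexp_mul_I (Lp.aestronglyMeasurable Z))
      (integrable_cexp_mul_I (Lp.aestronglyMeasurable W))]
  have hZW : MemLp (fun ω => Z ω - W ω) 2 P := (Lp.memLp Z).sub (Lp.memLp W)
  calc ‖∫ ω, (Complex.exp (Z ω * Complex.I) - Complex.exp (W ω * Complex.I)) ∂P‖
      ≤ ∫ ω, ‖Z ω - W ω‖ ∂P :=
        norm_integral_le_of_norm_le (hZW.integrable (by norm_num)).norm
          (ae_of_all _ fun ω => norm_cexp_mul_I_sub_cexp_mul_I_le _ _)
    _ = (eLpNorm (fun ω => Z ω - W ω) 1 P).toReal := by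
        rw [eLpNorm_one_eq_lintegral_enorm, integral_norm_eq_lintegral_enorm hZW.1]
    _ ≤ (eLpNorm (fun ω => Z ω - W ω) 2 P).toReal :=
        ENNReal.toReal_mono hZW.2.ne (eLpNorm_le_eLpNorm_of_exponent_le (by norm_num) hZW.1)
    _ = ‖Z - W‖ := by
        rw [Lp.norm_def, eLpNorm_congr_ae (Lp.coeFn_sub Z W)]
        rfl

lemma inner_toLp_eq_integral {X Y : Ω → ℝ} (hX : MemLp X 2 P) (hY : MemLp Y 2 P) :
    inner ℝ (hX.toLp X) (hY.toLp Y) = ∫ ω, X ω * Y ω ∂P := by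
  rw [L2.inner_def]
  refine integral_congr_ae ?_
  filter_upwards [hX.coeFn_toLp, hY.coeFn_toLp] with ω h1 h2
  rw [h1, h2]
  simp [mul_comm]

lemma coeFn_sum_smul_toLp {ι : Type*} (s : Finset ι) (c : ι → ℝ) {X : ι → Ω → ℝ}
    (hX : ∀ i, MemLp (X i) 2 P) :
    (∑ i ∈ s, c i • (hX i).toLp (X i) : Lp ℝ 2 P) =ᵐ[P] fun ω => ∑ i ∈ s, c i * X i ω := by
  classical
  induction s using Finset.induction_on with
  | empty =>
    filter_upwards [Lp.coeFn_zero ℝ 2 P] with ω h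
    simpa using h
  | insert i s hi ih =>
    rw [Finset.sum_insert hi]
    filter_upwards [Lp.coeFn_add (c i • (hX i).toLp (X i)) (∑ i ∈ s, c i • (hX i).toLp (X i)),
      Lp.coeFn_smul (c i) ((hX i).toLp (X i)), (hX i).coeFn_toLp, ih] with ω h1 h2 h3 h4
    rw [h1, Pi.add_apply, h2, h4, Pi.smul_apply, h3, Finset.sum_insert hi, smul_eq_mul]

lemma norm_sq_sum_smul_toLp {ι : Type*} (s : Finset ι) (c : ι → ℝ) {X : ι → Ω → ℝ}
    (hX : ∀ i, MemLp (X i) 2 P) :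
    ‖∑ i ∈ s, c i • (hX i).toLp (X i)‖ ^ 2 =
      ∑ i ∈ s, ∑ j ∈ s, c i * (c j * ∫ ω, X i ω * X j ω ∂P) := by
  rw [← real_inner_self_eq_norm_sq, sum_inner]
  refine Finset.sum_congr rfl fun i _ => ?_
  rw [inner_sum]
  refine Finset.sum_congr rfl fun j _ => ?_
  rw [real_inner_smul_left, real_inner_smul_right, inner_toLp_eq_integral]

/-- For a centered Gaussian process every element `Z` of its Gaussian space satisfies
`E exp(iZ) = exp(-‖Z‖² / 2)`: this holds on the linear span, and both sides are continuous
on `L²`. -/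
lemma integral_cexp_of_mem_gaussianSpace [IsProbabilityMeasure P] {B : T → Ω → ℝ}
    (hG : IsGaussianProcess B P) (h0 : ∀ t, ∫ ω, B t ω ∂P = 0) (hB : ∀ t, MemLp (B t) 2 P)
    {Z : Lp ℝ 2 P} (hZ : Z ∈ gaussianSpace B hB) :
    ∫ ω, Complex.exp (Z ω * Complex.I) ∂P = Complex.exp (-(‖Z‖ : ℂ) ^ 2 / 2) := by
  have hcl : IsClosed {Z : Lp ℝ 2 P |
      ∫ ω, Complex.exp (Z ω * Complex.I) ∂P = Complex.exp (-(‖Z‖ : ℂ) ^ 2 / 2)} :=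
    isClosed_eq continuous_integral_cexp_mul_I (by fun_prop)
  refine closure_minimal ?_ hcl hZ
  intro Z hZ
  obtain ⟨c, rfl⟩ := Finsupp.mem_span_range_iff_exists_finsupp.1 hZ
  have hlaw : HasGaussianLaw (fun ω => ∑ t ∈ c.support, c t * B t ω) P := by
    simpa using (hG.smul c).hasGaussianLaw_fun_sum (I := c.support)
  have hae := coeFn_sum_smul_toLp c.support c hB
  have hmean : ∫ ω, ∑ t ∈ c.support, c t * B t ω ∂P = 0 := by
    rw [integral_finsetSum _ fun t _ => ((hB t).integrable (by norm_num)).const_mul _]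
    simp [integral_const_mul, h0]
  have hvar : Var[fun ω => ∑ t ∈ c.support, c t * B t ω; P] =
      ‖∑ t ∈ c.support, c t • (hB t).toLp (B t)‖ ^ 2 := by
    rw [variance_of_integral_eq_zero hlaw.aemeasurable hmean, ← real_inner_self_eq_norm_sq,
      L2.inner_def]
    refine integral_congr_ae ?_
    filter_upwards [hae] with ω h
    rw [h]
    simp [sq]
  have hchar := hlaw.charFun_map_eq 1
  simp only [charFun_apply_real, RCLike.inner_apply, conj_trivial, mul_one] at hchar
  rw [integral_map hlaw.aemeasurable (by fun_prop), hmean, hvar] at hchar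
  change ∫ ω, Complex.exp ((∑ t ∈ c.support, c t • (hB t).toLp (B t) : Lp ℝ 2 P) ω *
    Complex.I) ∂P = Complex.exp (-(‖∑ t ∈ c.support, c t • (hB t).toLp (B t)‖ : ℂ) ^ 2 / 2)
  rw [integral_congr_ae (hae.mono fun ω h => by rw [h])]
  simp only [Complex.ofReal_one, one_mul] at hchar
  rw [hchar]
  congr 1
  push_cast
  ring

/-- The characteristic function of a finite family in the Gaussian space is determined by its
covariances. -/
lemma integral_cexp_sum_eq [IsProbabilityMeasure P] {B : T → Ω → ℝ}
    (hG : IsGaussianProcess B P) (h0 : ∀ t, ∫ ω, B t ω ∂P = 0) (hB : ∀ t, MemLp (B t) 2 P)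
    {ι : Type*} [Fintype ι] {X : ι → Ω → ℝ} (hX : ∀ i, MemLp (X i) 2 P)
    (hXB : ∀ i, (hX i).toLp (X i) ∈ gaussianSpace B hB) (c : ι → ℝ) :
    ∫ ω, Complex.exp ((∑ i, c i * X i ω : ℝ) * Complex.I) ∂P =
      Complex.exp (-((∑ i, ∑ j, c i * (c j * ∫ ω, X i ω * X j ω ∂P) : ℝ) : ℂ) / 2) := by
  have hmem : (∑ i, c i • (hX i).toLp (X i)) ∈ gaussianSpace B hB :=
    Submodule.sum_mem _ fun i _ => Submodule.smul_mem _ _ (hXB i)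
  have h := integral_cexp_of_mem_gaussianSpace hG h0 hB hmem
  rw [integral_congr_ae ((coeFn_sum_smul_toLp Finset.univ c hX).mono fun ω h => by rw [h]),
    ← Complex.ofReal_pow, norm_sq_sum_smul_toLp] at h
  exact h

lemma hasGaussianLaw_of_mem_gaussianSpace [IsProbabilityMeasure P] {B : T → Ω → ℝ}
    (hG : IsGaussianProcess B P) (h0 : ∀ t, ∫ ω, B t ω ∂P = 0) (hB : ∀ t, MemLp (B t) 2 P)
    {X : Ω → ℝ} (hX : MemLp X 2 P) (hXB : hX.toLp X ∈ gaussianSpace B hB) :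
    HasGaussianLaw X P := by
  have hlaw : P.map X = gaussianReal 0 (∫ ω, X ω * X ω ∂P).toNNReal := by
    have := Measure.isProbabilityMeasure_map hX.1.aemeasurable
    refine Measure.ext_of_charFun (funext fun ξ => ?_)
    rw [charFun_gaussianReal, charFun_apply_real, integral_map hX.1.aemeasurable (by fun_prop)]
    have h := integral_cexp_sum_eq hG h0 hB (ι := Unit) (fun _ => hX) (fun _ => hXB) (fun _ => ξ)
    simp only [Finset.univ_unique, Finset.sum_singleton, Complex.ofReal_mul] at h
    rw [h, Real.coe_toNNReal _ (integral_nonneg fun ω => mul_self_nonneg _)]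
    congr 1
    push_cast
    ring
  exact ⟨by rw [hlaw]; infer_instance⟩

/-- Two finite families in the Gaussian space with the same covariances have the same law. -/
lemma identDistrib_of_mem_gaussianSpace [IsProbabilityMeasure P] {B : T → Ω → ℝ}
    (hG : IsGaussianProcess B P) (h0 : ∀ t, ∫ ω, B t ω ∂P = 0) (hB : ∀ t, MemLp (B t) 2 P)
    {ι : Type*} [Fintype ι] {X Y : ι → Ω → ℝ} (hX : ∀ i, MemLp (X i) 2 P)
    (hXB : ∀ i, (hX i).toLp (X i) ∈ gaussianSpace B hB) (hY : ∀ i, MemLp (Y i) 2 P)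
    (hYB : ∀ i, (hY i).toLp (Y i) ∈ gaussianSpace B hB)
    (hcov : ∀ i j, ∫ ω, X i ω * X j ω ∂P = ∫ ω, Y i ω * Y j ω ∂P) :
    IdentDistrib (fun ω i => X i ω) (fun ω i => Y i ω) P P := by
  have hmX : AEMeasurable (fun ω i => X i ω) P :=
    aemeasurable_pi_lambda _ fun i => (hX i).1.aemeasurable
  have hmY : AEMeasurable (fun ω i => Y i ω) P :=
    aemeasurable_pi_lambda _ fun i => (hY i).1.aemeasurable
  refine ⟨hmX, hmY, Measure.ext_of_charFunDual (funext fun L => ?_)⟩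
  classical
  have hL : ∀ x : ι → ℝ, L x = ∑ i, L (Pi.single i 1) * x i := fun x => by
    conv_lhs => rw [pi_eq_sum_univ' x, map_sum]
    refine Finset.sum_congr rfl fun i _ => ?_
    rw [map_smul, smul_eq_mul, mul_comm]
  rw [charFunDual_apply, charFunDual_apply, integral_map hmX (by fun_prop),
    integral_map hmY (by fun_prop)]
  have e : ∀ Z : ι → Ω → ℝ, (fun ω => Complex.exp (L (fun i => Z i ω) * Complex.I)) =
      fun ω => Complex.exp ((∑ i, L (Pi.single i 1) * Z i ω : ℝ) * Complex.I) := fun Z =>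
    funext fun ω => by rw [hL fun i => Z i ω]
  rw [e X, e Y, integral_cexp_sum_eq hG h0 hB hX hXB, integral_cexp_sum_eq hG h0 hB hY hYB]
  simp_rw [hcov]

end GaussianSpace

/-! ### Path-by-path integrals of second-order processes -/

section PathIntegral

variable {T Ω : Type*} [MeasurableSpace T] [MeasurableSpace Ω] {μ : Measure T} {P : Measure Ω}
  {f : T → ℝ} {B : T → Ω → ℝ}

/-- The integrability hypothesis on `t ↦ f t * E (B t)²`, used throughout this part, makes
`f t * B t ω` absolutely integrable, with square-integrable integral in `t`. -/
lemma integrable_mul_sq_of_second_moment [SFinite P] (hf : Integrable f μ)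
    (hm : AEMeasurable (fun p : T × Ω => B p.1 p.2) (μ.prod P))
    (hB : ∀ t, MemLp (B t) 2 P) (hint : Integrable (fun t => f t * ∫ ω, B t ω ^ 2 ∂P) μ) :
    Integrable (fun p : T × Ω => f p.1 * B p.1 p.2 ^ 2) (μ.prod P) := by
  have hmeas : AEStronglyMeasurable (fun p : T × Ω => f p.1 * B p.1 p.2 ^ 2) (μ.prod P) :=
    hf.1.comp_fst.mul (hm.pow_const 2).aestronglyMeasurable
  rw [integrable_prod_iff hmeas]
  refine ⟨ae_of_all _ fun t => (hB t).integrable_sq.const_mul (f t), ?_⟩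
  refine hint.norm.congr (ae_of_all _ fun t => ?_)
  simp only [norm_mul, integral_const_mul]
  congr 1
  rw [Real.norm_of_nonneg (integral_nonneg fun ω => sq_nonneg _)]
  refine integral_congr_ae (ae_of_all _ fun ω => ?_)
  simp

lemma integrable_mul_mul_of_second_moment [IsFiniteMeasure P] [SFinite μ] (hf : Integrable f μ)
    (hm : AEMeasurable (fun p : T × Ω => B p.1 p.2) (μ.prod P))
    (hB : ∀ t, MemLp (B t) 2 P) (hint : Integrable (fun t => f t * ∫ ω, B t ω ^ 2 ∂P) μ)
    {Y : Ω → ℝ} (hY : MemLp Y 2 P) :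
    Integrable (fun p : T × Ω => f p.1 * B p.1 p.2 * Y p.2) (μ.prod P) := by
  have h1 := (integrable_mul_sq_of_second_moment hf hm hB hint).norm
  have h2 := (hf.mul_prod hY.integrable_sq).norm
  refine (h1.add h2).mono' ((hf.1.comp_fst.mul hm.aestronglyMeasurable).mul hY.1.comp_snd)
    (ae_of_all _ fun p => ?_)
  simp only [norm_mul, norm_pow, Pi.add_apply, Real.norm_eq_abs]
  have := abs_nonneg (f p.1)
  nlinarith [sq_nonneg (|B p.1 p.2| - |Y p.2|), sq_nonneg (|B p.1 p.2|), sq_nonneg (|Y p.2|),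
    mul_nonneg this (sq_nonneg (|B p.1 p.2| - |Y p.2|)), mul_nonneg this (sq_nonneg (|B p.1 p.2|)),
    mul_nonneg this (sq_nonneg (|Y p.2|))]

lemma integrable_mul_of_second_moment [IsFiniteMeasure P] [SFinite μ] (hf : Integrable f μ)
    (hm : AEMeasurable (fun p : T × Ω => B p.1 p.2) (μ.prod P))
    (hB : ∀ t, MemLp (B t) 2 P) (hint : Integrable (fun t => f t * ∫ ω, B t ω ^ 2 ∂P) μ) :
    Integrable (fun p : T × Ω => f p.1 * B p.1 p.2) (μ.prod P) := by
  simpa using integrable_mul_mul_of_second_moment hf hm hB hint (memLp_const (1 : ℝ))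

/-- Cauchy–Schwarz inequality for the weight `|f|`: the quadratic `x ↦ ∫ |f| (x + |g|)²` is
nonnegative. -/
lemma sq_integral_mul_le {g : T → ℝ} (hf : Integrable f μ) (hfg : Integrable (fun t => f t * g t) μ)
    (hfg2 : Integrable (fun t => f t * g t ^ 2) μ) :
    (∫ t, f t * g t ∂μ) ^ 2 ≤ (∫ t, |f t| ∂μ) * ∫ t, |f t * g t ^ 2| ∂μ := by
  have hE : |∫ t, f t * g t ∂μ| ≤ ∫ t, |f t * g t| ∂μ := abs_integral_le_integral_abs
  have hd : discrim (∫ t, |f t| ∂μ) (2 * ∫ t, |f t * g t| ∂μ) (∫ t, |f t * g t ^ 2| ∂μ) ≤ 0 := by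
    refine discrim_le_zero fun x => ?_
    have : (∫ t, |f t| ∂μ) * (x * x) + (2 * ∫ t, |f t * g t| ∂μ) * x + ∫ t, |f t * g t ^ 2| ∂μ =
        ∫ t, |f t| * (x + |g t|) ^ 2 ∂μ := by
      have e : ∀ t, |f t| * (x + |g t|) ^ 2 =
          |f t| * (x * x) + (2 * x) * |f t * g t| + |f t * g t ^ 2| := fun t => by
        rw [abs_mul, abs_mul, abs_pow]; ring
      simp_rw [e]
      have i1 := hf.abs.mul_const (x * x)
      have i2 := hfg.abs.const_mul (2 * x)
      have i3 : Integrable (fun t => |f t| * (x * x) + 2 * x * |f t * g t|) μ := i1.add i2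
      rw [integral_add i3 hfg2.abs, integral_add i1 i2, integral_mul_const,
        integral_const_mul]
      ring
    rw [this]
    exact integral_nonneg fun t => by positivity
  rw [discrim] at hd
  nlinarith [sq_abs (∫ t, f t * g t ∂μ), abs_nonneg (∫ t, f t * g t ∂μ)]

lemma memLp_integral_of_second_moment [IsFiniteMeasure P] [SFinite μ] (hf : Integrable f μ)
    (hm : AEMeasurable (fun p : T × Ω => B p.1 p.2) (μ.prod P))
    (hB : ∀ t, MemLp (B t) 2 P) (hint : Integrable (fun t => f t * ∫ ω, B t ω ^ 2 ∂P) μ) :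
    MemLp (fun ω => ∫ t, f t * B t ω ∂μ) 2 P := by
  have h1 := integrable_mul_of_second_moment hf hm hB hint
  have h2 := integrable_mul_sq_of_second_moment hf hm hB hint
  have hmeas : AEStronglyMeasurable (fun ω => ∫ t, f t * B t ω ∂μ) P := h1.integral_prod_right.1
  rw [memLp_two_iff_integrable_sq hmeas]
  refine (h2.abs.integral_prod_right.const_mul (∫ t, |f t| ∂μ)).mono' (hmeas.pow 2) ?_
  filter_upwards [h1.prod_left_ae, h2.prod_left_ae] with ω i1 i2
  rw [Real.norm_of_nonneg (sq_nonneg _)]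
  exact sq_integral_mul_le hf i1 i2

/-- Fubini against a square-integrable `Y`: it yields in turn the mean (`Y = 1`), the orthogonality
relations (`Y` orthogonal to the process) and the covariances (`Y` another coefficient). -/
lemma integral_integral_mul_of_second_moment [IsFiniteMeasure P] [SFinite μ] (hf : Integrable f μ)
    (hm : AEMeasurable (fun p : T × Ω => B p.1 p.2) (μ.prod P))
    (hB : ∀ t, MemLp (B t) 2 P) (hint : Integrable (fun t => f t * ∫ ω, B t ω ^ 2 ∂P) μ)
    {Y : Ω → ℝ} (hY : MemLp Y 2 P) :
    ∫ ω, (∫ t, f t * B t ω ∂μ) * Y ω ∂P = ∫ t, f t * ∫ ω, B t ω * Y ω ∂P ∂μ := by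
  have h := integral_integral_swap (f := fun t ω => f t * B t ω * Y ω)
    (integrable_mul_mul_of_second_moment hf hm hB hint hY)
  simp_rw [← integral_mul_const]
  rw [← h]
  simp_rw [mul_assoc, integral_const_mul]

/-- A path-by-path integral lies in the Gaussian space: it is orthogonal to every `Y ∈ L²` that
is orthogonal to all the `B t`. -/
lemma integral_mem_gaussianSpace [IsFiniteMeasure P] [SFinite μ] (hf : Integrable f μ)
    (hm : AEMeasurable (fun p : T × Ω => B p.1 p.2) (μ.prod P))
    (hB : ∀ t, MemLp (B t) 2 P) (hint : Integrable (fun t => f t * ∫ ω, B t ω ^ 2 ∂P) μ) :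
    (memLp_integral_of_second_moment hf hm hB hint).toLp _ ∈ gaussianSpace B hB := by
  rw [gaussianSpace, ← Submodule.orthogonal_orthogonal_eq_closure, Submodule.mem_orthogonal']
  intro Y hY
  have hYt : ∀ t, ∫ ω, B t ω * Y ω ∂P = 0 := fun t => by
    rw [← inner_toLp_eq_integral (hB t) (Lp.memLp Y), Lp.toLp_coeFn]
    exact (Submodule.mem_orthogonal _ _).1 hY _ (Submodule.subset_span ⟨t, rfl⟩)
  have h := inner_toLp_eq_integral (memLp_integral_of_second_moment hf hm hB hint) (Lp.memLp Y)
  rw [Lp.toLp_coeFn] at h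
  rw [h, integral_integral_mul_of_second_moment hf hm hB hint (Lp.memLp Y)]
  simp [hYt]

end PathIntegral

/-! ### Wavelet coefficients of the fractional Brownian sheet -/

section Sheet

variable {ψ : ℝ → ℝ}

lemma waveletFn_eq_zero {R : ℝ} (hsR : ∀ u, ψ u ≠ 0 → |u| ≤ R) (j k : ℤ) {t : ℝ}
    (ht : t ∉ Set.Icc ((2 : ℝ) ^ j * (k - R)) (2 ^ j * (k + R))) : waveletFn ψ j k t = 0 := by
  have h2 : (0 : ℝ) < 2 ^ j := by positivity
  rw [waveletFn]
  by_contra h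
  have h1 := abs_le.1 (hsR _ (right_ne_zero_of_mul h))
  rw [zpow_neg] at h1
  have e : t = 2 ^ j * (((2 : ℝ) ^ j)⁻¹ * t) := by field_simp
  refine ht ⟨?_, ?_⟩
  · rw [e]
    exact mul_le_mul_of_nonneg_left (by linarith) h2.le
  · rw [e]
    exact mul_le_mul_of_nonneg_left (by linarith) h2.le

lemma integrable_waveletFn (hψ : Integrable ψ) (j k : ℤ) : Integrable (waveletFn ψ j k) := by
  have h2 : (2 : ℝ) ^ (-j) ≠ 0 := by positivity
  exact ((hψ.comp_sub_right (k : ℝ)).comp_mul_left' h2).const_mul _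

variable {d : ℕ}

lemma integrable_tensorWavelet (hψ : Integrable ψ) (J K : Fin d → ℤ) :
    Integrable (tensorWavelet ψ J K) :=
  Integrable.fintype_prod (f := fun i => waveletFn ψ (J i) (K i))
    fun i => integrable_waveletFn hψ (J i) (K i)

lemma integrable_tensorWavelet_mul (hψ : Integrable ψ) (hs : HasCompactSupport ψ)
    (J K : Fin d → ℤ) {g : (Fin d → ℝ) → ℝ} (hg : Continuous g) :
    Integrable (fun t => tensorWavelet ψ J K t * g t) := by
  obtain ⟨R, -, hsR⟩ := hs.exists_abs_le
  refine (integrable_tensorWavelet hψ J K).mul_continuous_of_isCompact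
    (isCompact_univ_pi fun i => isCompact_Icc (a := (2 : ℝ) ^ J i * (K i - R))
      (b := 2 ^ J i * (K i + R))) (fun t ht => ?_) hg
  simp only [Set.mem_pi, Set.mem_univ, true_imp_iff, not_forall] at ht
  obtain ⟨i, hi⟩ := ht
  exact Finset.prod_eq_zero (Finset.mem_univ i) (waveletFn_eq_zero hsR _ _ hi)

variable {Ω : Type*} [MeasurableSpace Ω] {P : Measure Ω} {H : Fin d → ℝ}
  {B : (Fin d → ℝ) → Ω → ℝ}

namespace IsFractionalBrownianSheet

lemma memLp (hB : IsFractionalBrownianSheet H B P) (t : Fin d → ℝ) : MemLp (B t) 2 P :=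
  (hB.gaussian.hasGaussianLaw_eval t).memLp_two

lemma integrable_tensorWavelet_mul_second_moment (hB : IsFractionalBrownianSheet H B P)
    (hH : ∀ i, 0 < H i) (hψ : Integrable ψ) (hs : HasCompactSupport ψ) (J K : Fin d → ℤ) :
    Integrable fun t => tensorWavelet ψ J K t * ∫ ω, B t ω ^ 2 ∂P := by
  simp_rw [sq, hB.cov]
  refine integrable_tensorWavelet_mul hψ hs J K (continuous_finsetProd _ fun i _ => ?_)
  have hp : (0 : ℝ) ≤ 2 * H i := by have := hH i; positivity
  simp only [fbmCov, sub_self, abs_zero]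
  have : Continuous fun t : Fin d → ℝ => |t i| ^ (2 * H i) :=
    (continuous_apply i).abs.rpow_const fun _ => Or.inr hp
  fun_prop

variable [IsProbabilityMeasure P]

lemma memLp_waveletCoeff (hB : IsFractionalBrownianSheet H B P)
    (hm : AEMeasurable (fun p : (Fin d → ℝ) × Ω => B p.1 p.2) (volume.prod P))
    (hH : ∀ i, 0 < H i) (hψ : Integrable ψ) (hs : HasCompactSupport ψ) (J K : Fin d → ℤ) :
    MemLp (waveletCoeff ψ B J K) 2 P :=
  memLp_integral_of_second_moment (integrable_tensorWavelet hψ J K) hm hB.memLp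
    (hB.integrable_tensorWavelet_mul_second_moment hH hψ hs J K)

lemma waveletCoeff_mem_gaussianSpace (hB : IsFractionalBrownianSheet H B P)
    (hm : AEMeasurable (fun p : (Fin d → ℝ) × Ω => B p.1 p.2) (volume.prod P))
    (hH : ∀ i, 0 < H i) (hψ : Integrable ψ) (hs : HasCompactSupport ψ) (J K : Fin d → ℤ) :
    (hB.memLp_waveletCoeff hm hH hψ hs J K).toLp _ ∈ gaussianSpace B hB.memLp :=
  integral_mem_gaussianSpace (integrable_tensorWavelet hψ J K) hm hB.memLp
    (hB.integrable_tensorWavelet_mul_second_moment hH hψ hs J K)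

lemma ae_integrable_tensorWavelet_mul (hB : IsFractionalBrownianSheet H B P)
    (hm : AEMeasurable (fun p : (Fin d → ℝ) × Ω => B p.1 p.2) (volume.prod P))
    (hH : ∀ i, 0 < H i) (hψ : Integrable ψ) (hs : HasCompactSupport ψ) (J K : Fin d → ℤ) :
    ∀ᵐ ω ∂P, Integrable (fun t : Fin d → ℝ => tensorWavelet ψ J K t * B t ω) volume :=
  (integrable_mul_of_second_moment (integrable_tensorWavelet hψ J K) hm hB.memLp
    (hB.integrable_tensorWavelet_mul_second_moment hH hψ hs J K)).prod_left_ae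

lemma integral_waveletCoeff (hB : IsFractionalBrownianSheet H B P)
    (hm : AEMeasurable (fun p : (Fin d → ℝ) × Ω => B p.1 p.2) (volume.prod P))
    (hH : ∀ i, 0 < H i) (hψ : Integrable ψ) (hs : HasCompactSupport ψ) (J K : Fin d → ℤ) :
    ∫ ω, waveletCoeff ψ B J K ω ∂P = 0 := by
  have h := integral_integral_mul_of_second_moment (integrable_tensorWavelet hψ J K) hm hB.memLp
    (hB.integrable_tensorWavelet_mul_second_moment hH hψ hs J K) (memLp_const (1 : ℝ))
  simpa [hB.mean_zero, waveletCoeff] using h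

/-- The covariance of two wavelet coefficients is the product over the coordinates of
one-dimensional double integrals. -/
lemma integral_waveletCoeff_mul (hB : IsFractionalBrownianSheet H B P)
    (hm : AEMeasurable (fun p : (Fin d → ℝ) × Ω => B p.1 p.2) (volume.prod P))
    (hH : ∀ i, 0 < H i) (hψ : Integrable ψ) (hs : HasCompactSupport ψ) (J J' K K' : Fin d → ℤ) :
    ∫ ω, waveletCoeff ψ B J K ω * waveletCoeff ψ B J' K' ω ∂P =
      ∏ i, ∫ t : ℝ, ∫ s : ℝ,
        waveletFn ψ (J i) (K i) t * waveletFn ψ (J' i) (K' i) s * fbmCov (H i) s t := by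
  have h1 : ∀ t, ∫ ω, B t ω * waveletCoeff ψ B J' K' ω ∂P =
      ∏ i, ∫ s : ℝ, waveletFn ψ (J' i) (K' i) s * fbmCov (H i) s (t i) := fun t => by
    simp_rw [mul_comm (B t _)]
    have h := integral_integral_mul_of_second_moment (integrable_tensorWavelet hψ J' K') hm
      hB.memLp (hB.integrable_tensorWavelet_mul_second_moment hH hψ hs J' K') (hB.memLp t)
    simp_rw [hB.cov, tensorWavelet, ← Finset.prod_mul_distrib] at h
    rw [integral_fintype_prod_volume_eq_prod
      (fun i s => waveletFn ψ (J' i) (K' i) s * fbmCov (H i) s (t i))] at h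
    exact h
  have h2 := integral_integral_mul_of_second_moment (integrable_tensorWavelet hψ J K) hm
    hB.memLp (hB.integrable_tensorWavelet_mul_second_moment hH hψ hs J K)
    (hB.memLp_waveletCoeff hm hH hψ hs J' K')
  simp_rw [h1, tensorWavelet, ← Finset.prod_mul_distrib] at h2
  rw [integral_fintype_prod_volume_eq_prod (fun i t => waveletFn ψ (J i) (K i) t *
    ∫ s : ℝ, waveletFn ψ (J' i) (K' i) s * fbmCov (H i) s t)] at h2
  simp_rw [mul_assoc, integral_const_mul]
  exact h2

lemma integral_waveletCoeff_mul_eq_kernel (hB : IsFractionalBrownianSheet H B P)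
    (hm : AEMeasurable (fun p : (Fin d → ℝ) × Ω => B p.1 p.2) (volume.prod P))
    (hH : ∀ i, 0 < H i) (hψ : Integrable ψ) (hs : HasCompactSupport ψ) (h0 : ∫ u, ψ u = 0)
    (J J' K K' : Fin d → ℤ) :
    ∫ ω, waveletCoeff ψ B J K ω * waveletCoeff ψ B J' K' ω ∂P =
      ∏ i, (-(1 / 2) * ((2 : ℝ) ^ ((J i : ℝ) / 2) * (2 : ℝ) ^ ((J' i : ℝ) / 2)) *
        waveletKernel ψ (H i) (2 ^ J i) (2 ^ J' i) (2 ^ J i * K i - 2 ^ J' i * K' i)) := by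
  rw [hB.integral_waveletCoeff_mul hm hH hψ hs]
  exact Finset.prod_congr rfl fun i _ =>
    integral_integral_waveletFn_fbmCov hψ hs h0 (hH i) _ _ _ _

lemma integral_waveletCoeff_mul_scaling (hB : IsFractionalBrownianSheet H B P)
    (hm : AEMeasurable (fun p : (Fin d → ℝ) × Ω => B p.1 p.2) (volume.prod P))
    (hH : ∀ i, 0 < H i) (hψ : Integrable ψ) (hs : HasCompactSupport ψ) (h0 : ∫ u, ψ u = 0)
    (J K K' : Fin d → ℤ) :
    ∫ ω, waveletCoeff ψ B J K ω * waveletCoeff ψ B J K' ω ∂P =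
      ((2 : ℝ) ^ (∑ i, (J i : ℝ) * (H i + 1 / 2))) ^ 2 *
        ∫ ω, waveletCoeff ψ B 0 K ω * waveletCoeff ψ B 0 K' ω ∂P := by
  rw [hB.integral_waveletCoeff_mul_eq_kernel hm hH hψ hs h0,
    hB.integral_waveletCoeff_mul_eq_kernel hm hH hψ hs h0,
    Real.rpow_sum_of_pos two_pos, ← Finset.prod_pow, ← Finset.prod_mul_distrib]
  refine Finset.prod_congr rfl fun i _ => ?_
  rw [← mul_sub, waveletKernel_mul (by positivity)]
  simp only [Pi.zero_apply, Int.cast_zero, zero_div, Real.rpow_zero, zpow_zero, one_mul, mul_one]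
  have e : ((2 : ℝ) ^ ((J i : ℝ) * (H i + 1 / 2))) ^ 2 =
      2 ^ ((J i : ℝ) / 2) * 2 ^ ((J i : ℝ) / 2) * ((2 : ℝ) ^ J i) ^ (2 * H i) := by
    rw [← Real.rpow_intCast, ← Real.rpow_mul two_pos.le, ← Real.rpow_natCast,
      ← Real.rpow_mul two_pos.le, ← Real.rpow_add two_pos, ← Real.rpow_add two_pos]
    congr 1
    push_cast
    ring
  rw [e]
  ring

/-- At a fixed octave `2 ^ j * k - 2 ^ j * k'` depends on `k - k'` only. -/
lemma integral_waveletCoeff_mul_add (hB : IsFractionalBrownianSheet H B P)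
    (hm : AEMeasurable (fun p : (Fin d → ℝ) × Ω => B p.1 p.2) (volume.prod P))
    (hH : ∀ i, 0 < H i) (hψ : Integrable ψ) (hs : HasCompactSupport ψ) (h0 : ∫ u, ψ u = 0)
    (J K K' L : Fin d → ℤ) :
    ∫ ω, waveletCoeff ψ B J (K + L) ω * waveletCoeff ψ B J (K' + L) ω ∂P =
      ∫ ω, waveletCoeff ψ B J K ω * waveletCoeff ψ B J K' ω ∂P := by
  rw [hB.integral_waveletCoeff_mul_eq_kernel hm hH hψ hs h0,
    hB.integral_waveletCoeff_mul_eq_kernel hm hH hψ hs h0]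
  refine Finset.prod_congr rfl fun i _ => ?_
  congr 2
  simp only [Pi.add_apply]
  push_cast
  ring

end IsFractionalBrownianSheet

lemma tendsto_farApart (J J' : Fin d → ℤ) (i : Fin d) :
    Tendsto (fun p : (Fin d → ℤ) × (Fin d → ℤ) =>
      (2 : ℝ) ^ J i * (p.1 i : ℝ) - 2 ^ J' i * (p.2 i : ℝ)) (farApart J J')
      (comap (fun x : ℝ => |x|) atTop) := by
  rw [tendsto_comap_iff]
  refine tendsto_atTop_mono (fun p => ?_) tendsto_comap
  exact ciInf_le (Set.finite_range _).bddBelow i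

end Sheet

theorem proposition1 {d : ℕ} (hd : 1 ≤ d) (H : Fin d → ℝ) (hH : ∀ i, H i ∈ Set.Ioo (0 : ℝ) 1)
    (ψ : ℝ → ℝ) (hψ : IsOrthonormalWavelet ψ) (hsupp : HasCompactSupport ψ)
    (N : ℕ) (hN : 1 ≤ N) (hmom : HasVanishingMoments ψ N)
    {Ω : Type*} [MeasurableSpace Ω] (P : Measure Ω) [IsProbabilityMeasure P]
    (B : (Fin d → ℝ) → Ω → ℝ) (hB : IsFractionalBrownianSheet H B P)
    (hBmeas : AEMeasurable (fun p : (Fin d → ℝ) × Ω => B p.1 p.2) (volume.prod P)) :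
    -- the coefficients are well defined, centered and Gaussian
    (∀ J K : Fin d → ℤ,
      (∀ᵐ ω ∂P, Integrable (fun t : Fin d → ℝ => tensorWavelet ψ J K t * B t ω) volume) ∧
      HasGaussianLaw (waveletCoeff ψ B J K) P ∧
      ∫ ω, waveletCoeff ψ B J K ω ∂P = 0) ∧
    -- scaling in law at a fixed octave
    (∀ (J : Fin d → ℤ) (n : ℕ) (K : Fin n → Fin d → ℤ),
      IdentDistrib
        (fun ω (m : Fin n) => waveletCoeff ψ B J (K m) ω)
        (fun ω (m : Fin n) =>
          (2 : ℝ) ^ (∑ i, (J i : ℝ) * (H i + 1 / 2)) * waveletCoeff ψ B 0 (K m) ω) P P) ∧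
    -- joint stationarity in the translation
    (∀ (J : Fin d → ℤ) (n : ℕ) (K : Fin n → Fin d → ℤ) (L : Fin d → ℤ),
      IdentDistrib
        (fun ω (m : Fin n) => waveletCoeff ψ B J (K m + L) ω)
        (fun ω (m : Fin n) => waveletCoeff ψ B J (K m) ω) P P) ∧
    -- factorization of the covariance into one-dimensional double integrals
    (∀ J J' K K' : Fin d → ℤ,
      ∫ ω, waveletCoeff ψ B J K ω * waveletCoeff ψ B J' K' ω ∂P =
        ∏ i, ∫ t : ℝ, ∫ s : ℝ,
          waveletFn ψ (J i) (K i) t * waveletFn ψ (J' i) (K' i) s * fbmCov (H i) s t) ∧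
    -- factorization into covariances of wavelet coefficients of fractional Brownian motions
    (∀ (Ω' : Fin d → Type*) [∀ i, MeasurableSpace (Ω' i)] (P' : ∀ i, Measure (Ω' i))
      [∀ i, IsProbabilityMeasure (P' i)] (W : ∀ i, (Fin 1 → ℝ) → Ω' i → ℝ),
      (∀ i, IsFractionalBrownianSheet (fun _ : Fin 1 => H i) (W i) (P' i)) →
      (∀ i, AEMeasurable (fun p : (Fin 1 → ℝ) × Ω' i => W i p.1 p.2) (volume.prod (P' i))) →
      ∀ J J' K K' : Fin d → ℤ,
        ∫ ω, waveletCoeff ψ B J K ω * waveletCoeff ψ B J' K' ω ∂P =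
          ∏ i, ∫ ω, waveletCoeff ψ (W i) (fun _ => J i) (fun _ => K i) ω *
            waveletCoeff ψ (W i) (fun _ => J' i) (fun _ => K' i) ω ∂(P' i)) ∧
    -- decay of the covariance
    (∀ J J' : Fin d → ℤ, ∃ C : ℝ,
      Tendsto
        (fun p : (Fin d → ℤ) × (Fin d → ℤ) =>
          (∫ ω, waveletCoeff ψ B J p.1 ω * waveletCoeff ψ B J' p.2 ω ∂P) /
            ∏ i, |(2 : ℝ) ^ (J i) * (p.1 i : ℝ) - (2 : ℝ) ^ (J' i) * (p.2 i : ℝ)| ^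
              (2 * H i - 2 * (N : ℝ)))
        (farApart J J') (𝓝 C) ∧
      ((∀ i, H i ≠ 1 / 2) → C ≠ 0) ∧
      ((∃ i, H i = 1 / 2) → ∀ᶠ p in farApart J J',
        ∫ ω, waveletCoeff ψ B J p.1 ω * waveletCoeff ψ B J' p.2 ω ∂P = 0)) := by

  have hH0 : ∀ i, 0 < H i := fun i => (hH i).1
  have hint : Integrable ψ := by simpa using hmom.integrable 0 (Nat.zero_le _)
  have h0 : ∫ u, ψ u = 0 := by simpa using hmom.moment_eq_zero 0 hN
  have hmem := hB.memLp_waveletCoeff hBmeas hH0 hint hsupp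
  have hspan := hB.waveletCoeff_mem_gaussianSpace hBmeas hH0 hint hsupp
  refine ⟨fun J K => ⟨hB.ae_integrable_tensorWavelet_mul hBmeas hH0 hint hsupp J K,
    hasGaussianLaw_of_mem_gaussianSpace hB.gaussian hB.mean_zero hB.memLp (hmem J K) (hspan J K),
    hB.integral_waveletCoeff hBmeas hH0 hint hsupp J K⟩, fun J n K => ?_, fun J n K L => ?_,
    hB.integral_waveletCoeff_mul hBmeas hH0 hint hsupp, ?_, fun J J' => ?_⟩
  · refine identDistrib_of_mem_gaussianSpace hB.gaussian hB.mean_zero hB.memLp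
      (X := fun m => waveletCoeff ψ B J (K m))
      (Y := fun m ω => (2 : ℝ) ^ (∑ i, (J i : ℝ) * (H i + 1 / 2)) * waveletCoeff ψ B 0 (K m) ω)
      (fun m => hmem J (K m)) (fun m => hspan J (K m)) (fun m => (hmem 0 (K m)).const_mul _)
      (fun m => Submodule.smul_mem _ _ (hspan 0 (K m))) fun m m' => ?_
    rw [hB.integral_waveletCoeff_mul_scaling hBmeas hH0 hint hsupp h0, ← integral_const_mul]
    refine integral_congr_ae (ae_of_all _ fun ω => ?_)
    ring
  · exact identDistrib_of_mem_gaussianSpace hB.gaussian hB.mean_zero hB.memLp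
      (X := fun m => waveletCoeff ψ B J (K m + L)) (Y := fun m => waveletCoeff ψ B J (K m))
      (fun m => hmem J _) (fun m => hspan J _) (fun m => hmem J _) (fun m => hspan J _)
      fun m m' => hB.integral_waveletCoeff_mul_add hBmeas hH0 hint hsupp h0 J (K m) (K m') L
  · intro Ω' _ P' _ W hW hWm J J' K K'
    rw [hB.integral_waveletCoeff_mul hBmeas hH0 hint hsupp]
    refine Finset.prod_congr rfl fun i _ => ?_
    rw [(hW i).integral_waveletCoeff_mul (hWm i) (fun _ => hH0 i) hint hsupp]
    simp
  · have hcov := hB.integral_waveletCoeff_mul_eq_kernel hBmeas hH0 hint hsupp h0 J J'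
    refine ⟨∏ i, (-(1 / 2) * ((2 : ℝ) ^ ((J i : ℝ) / 2) * (2 : ℝ) ^ ((J' i : ℝ) / 2)) *
      (Ring.choose (2 * H i) (2 * N) * (((2 : ℝ) ^ J i) ^ N * (-(2 : ℝ) ^ J' i) ^ N *
        ((2 * N).choose N : ℝ) * (∫ t : ℝ, t ^ N * ψ t) ^ 2))), ?_, ?_, ?_⟩
    · simp_rw [hcov, ← Finset.prod_div_distrib, mul_div_assoc]
      exact tendsto_finsetProd _ fun i _ => ((tendsto_waveletKernel_div hint hsupp
        hmom.moment_eq_zero (hH0 i) _ _).comp (tendsto_farApart J J' i)).const_mul _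
    · intro hne
      refine Finset.prod_ne_zero_iff.2 fun i _ => ?_
      -- `2 H i` lies in `(0, 2)` and differs from `1`, so no factor of the binomial vanishes
      have hchoose : Ring.choose (2 * H i) (2 * N) ≠ 0 := by
        refine Ring.choose_ne_zero_of_forall_ne_natCast (fun k hk => ?_) _
        have h1 : (0 : ℝ) < k := hk ▸ mul_pos two_pos (hH i).1
        have h2 : (k : ℝ) < 2 := by linarith [(hH i).2]
        have h3 : k = 1 := by
          have h1 : 0 < k := by exact_mod_cast h1
          have h2 : k < 2 := by exact_mod_cast h2
          omega
        rw [h3, Nat.cast_one] at hk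
        exact hne i (by linarith)
      have hb : ((2 * N).choose N : ℝ) ≠ 0 :=
        Nat.cast_ne_zero.2 (Nat.choose_pos (by omega)).ne'
      have hM := hmom.moment_ne_zero
      have hJ' : (-(2 : ℝ) ^ J' i) ^ N ≠ 0 := pow_ne_zero _ (neg_ne_zero.2 (by positivity))
      exact mul_ne_zero (mul_ne_zero (by norm_num) (by positivity))
        (mul_ne_zero hchoose (mul_ne_zero (mul_ne_zero (mul_ne_zero (by positivity) hJ') hb)
          (pow_ne_zero _ hM)))
    · rintro ⟨i, hi⟩
      filter_upwards [(tendsto_farApart J J' i).eventually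
        (waveletKernel_half_eventually_eq_zero hint hsupp hN hmom.moment_eq_zero (2 ^ J i)
          (2 ^ J' i))] with p hp
      rw [hcov]
      refine Finset.prod_eq_zero (Finset.mem_univ i) ?_
      rw [hi, hp, mul_zero]
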